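/- Let $\mathfrak{sv}$ be the Schrödinger-Virasoro algebra, i.e. the complex Lie algebra with $\mathbb{C}$-basis $\{L_n, M_n, Y_{n+\frac12} \mid n\in\mathbb{Z}\}$ and Lie brackets, for all $m,n\in\mathbb{Z}$, $$[L_m,L_n]=(n-m)L_{n+m},\qquad [L_m,M_n]=nM_{n+m},\qquad [L_m,Y_{n+\frac12}]=\Bigl(n+\frac{1-m}{2}\Bigr)Y_{m+n+\frac12},$$ $$[Y_{m+\frac12},Y_{n+\frac12}]=(n-m)M_{m+n+1},\qquad [M_m,M_n]=[M_m,Y_{n+\frac12}]=0.$$ Then the center of the universal enveloping algebra $U(\mathfrak{sv})$ is the subalgebra $\mathbb{C}[M_0]$ generated by $M_0$, and this subalgebra is a polynomial algebra in $M_0$, i.e. (the image in $U(\mathfrak{sv})$ of) $M_0$ is transcendental over $\mathbb{C}$. -/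

import Mathlib

/-- Labels of the standard basis of the Schrödinger-Virasoro algebra. For an integer `n` the
labels `L n`, `M n` and `Y n` stand for the basis vectors `L_n`, `M_n` and `Y_{n + 1/2}`. -/
inductive SVIndex : Type
  | L (n : ℤ)
  | M (n : ℤ)
  | Y (n : ℤ)

/-- The underlying vector space of the Schrödinger-Virasoro algebra: the complex vector space
with basis indexed by `SVIndex`. -/
def SV : Type := SVIndex →₀ ℂ

namespace SV

noncomputable instance : AddCommGroup SV := inferInstanceAs (AddCommGroup (SVIndex →₀ ℂ))

noncomputable instance : Module ℂ SV := inferInstanceAs (Module ℂ (SVIndex →₀ ℂ))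

/-- The standard basis `{L_n, M_n, Y_{n + 1/2} | n ∈ ℤ}`. -/
noncomputable def basis : Module.Basis SVIndex ℂ SV :=
  Module.Basis.ofRepr (LinearEquiv.refl ℂ (SVIndex →₀ ℂ))

/-- The element `L_n`. -/
noncomputable def L (n : ℤ) : SV := basis (SVIndex.L n)

/-- The element `M_n`. -/
noncomputable def M (n : ℤ) : SV := basis (SVIndex.M n)

/-- The element `Y_{n + 1/2}`. -/
noncomputable def Y (n : ℤ) : SV := basis (SVIndex.Y n)

/-- The Lie bracket of two basis vectors. -/
noncomputable def basisBracket : SVIndex → SVIndex → SV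
  | .L m, .L n => ((n : ℂ) - m) • L (n + m)
  | .L m, .M n => (n : ℂ) • M (n + m)
  | .L m, .Y n => ((n : ℂ) + (1 - m) / 2) • Y (m + n)
  | .M n, .L m => -((n : ℂ) • M (n + m))
  | .M _, .M _ => 0
  | .M _, .Y _ => 0
  | .Y n, .L m => -(((n : ℂ) + (1 - m) / 2) • Y (m + n))
  | .Y _, .M _ => 0
  | .Y m, .Y n => ((n : ℂ) - m) • M (m + n + 1)

/-- The bilinear extension of the bracket of basis vectors. -/
noncomputable def bracketHom : SV →ₗ[ℂ] SV →ₗ[ℂ] SV :=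
  basis.constr ℂ fun a => basis.constr ℂ fun b => basisBracket a b

theorem bracketHom_basis (a b : SVIndex) :
    bracketHom (basis a) (basis b) = basisBracket a b := by
  simp [bracketHom]

theorem basisBracket_skew (a b : SVIndex) : basisBracket a b = -basisBracket b a := by
  cases a <;> cases b <;> simp only [basisBracket, neg_neg, neg_zero] <;>
    rw [← neg_smul, neg_sub] <;> congr 2 <;> ring

theorem bracketHom_skew (x y : SV) : bracketHom x y = -bracketHom y x := by
  have h : bracketHom = -bracketHom.flip := by
    refine basis.ext fun a => basis.ext fun b => ?_
    simpa [bracketHom_basis] using basisBracket_skew a b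
  simpa using congrArg (fun f => f x y) h

theorem bracketHom_jacobi_basis (a b c : SVIndex) :
    bracketHom (basis a) (bracketHom (basis b) (basis c)) =
      bracketHom (bracketHom (basis a) (basis b)) (basis c) +
        bracketHom (basis b) (bracketHom (basis a) (basis c)) := by
  cases a <;> cases b <;> cases c <;>
    simp only [bracketHom_basis, basisBracket, L, M, Y, map_smul, map_neg, map_zero,
      LinearMap.smul_apply, LinearMap.neg_apply, LinearMap.zero_apply, smul_zero, neg_zero,
      add_zero, neg_neg, smul_neg] <;>
    push_cast <;> ring_nf <;> try module

theorem bracketHom_jacobi (x y z : SV) :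
    bracketHom x (bracketHom y z) =
      bracketHom (bracketHom x y) z + bracketHom y (bracketHom x z) := by
  have hz (a b : SVIndex) (z : SV) : bracketHom (basis a) (bracketHom (basis b) z) =
      bracketHom (bracketHom (basis a) (basis b)) z +
        bracketHom (basis b) (bracketHom (basis a) z) := by
    have h : bracketHom (basis a) ∘ₗ bracketHom (basis b) =
        bracketHom (bracketHom (basis a) (basis b)) +
          bracketHom (basis b) ∘ₗ bracketHom (basis a) :=
      basis.ext fun c => bracketHom_jacobi_basis a b c
    exact LinearMap.congr_fun h z
  have hy (a : SVIndex) (y z : SV) : bracketHom (basis a) (bracketHom y z) =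
      bracketHom (bracketHom (basis a) y) z + bracketHom y (bracketHom (basis a) z) := by
    have h : bracketHom (basis a) ∘ₗ bracketHom.flip z =
        bracketHom.flip z ∘ₗ bracketHom (basis a) +
          bracketHom.flip (bracketHom (basis a) z) :=
      basis.ext fun b => hz a b z
    exact LinearMap.congr_fun h y
  have h : bracketHom.flip (bracketHom y z) =
      bracketHom.flip z ∘ₗ bracketHom.flip y + bracketHom y ∘ₗ bracketHom.flip z :=
    basis.ext fun a => hy a y z
  exact LinearMap.congr_fun h x

noncomputable instance : LieRing SV where
  bracket x y := bracketHom x y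
  add_lie x y z := by simp
  lie_add x y z := by simp
  lie_self x := by
    have h := bracketHom_skew x x
    have h2 : (2 : ℂ) • bracketHom x x = 0 := by
      rw [two_smul]
      exact eq_neg_iff_add_eq_zero.mp h
    exact (smul_eq_zero.mp h2).resolve_left two_ne_zero
  leibniz_lie x y z := bracketHom_jacobi x y z

noncomputable instance : LieAlgebra ℂ SV where
  lie_smul t x y := map_smul (bracketHom x) t y

theorem lie_basis (a b : SVIndex) : ⁅basis a, basis b⁆ = basisBracket a b :=
  bracketHom_basis a b

end SV

/-! Filter $U(\mathfrak{sv})$ by word length. The top symbol of a central element is a polynomial in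
the symmetric algebra killed by the adjoint action. Such an $f$ involves finitely many variables, so
for suitable $n$ the variable $M_{n+m}$ is absent from $f$; differentiating $\mathrm{ad}(M_n) f = 0$
along it leaves $-n\,\partial f/\partial L_m = 0$. Taking $\mathrm{ad}(Y_n)$ and $\mathrm{ad}(L_n)$
instead removes every $Y_m$ and every $M_m$ with $m \ne 0$ (`pderiv_eq_zero_of_invariant`). The
symbol is thus $c M_0^k$; subtracting the central element $c M_0^k$ lowers the filtration degree,
and induction finishes (`mem_adjoin_of_commute`).

Symbols need a PBW-type input. It comes from a left-symmetric product on $\mathfrak{sv}$: it makes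
the symmetric algebra a $U(\mathfrak{sv})$-module on which $x$ acts as multiplication by $x$ plus a
degree-preserving derivation. Acting on $1$ and taking top degree gives the symbol; acting on $1$ by
powers of $M_0$ gives transcendence. -/

namespace SV

/-! ### Left-symmetric product and the affine action -/

open MvPolynomial

/-- The value on basis vectors of a left-symmetric (pre-Lie) product whose commutator is the
bracket of `SV`. -/
noncomputable def basisPreLie : SVIndex → SVIndex → SV
  | .L m, .L n => (n : ℂ) • L (n + m)
  | .L m, .M n => (n : ℂ) • M (n + m)
  | .L m, .Y n => ((n : ℂ) + (1 - m) / 2) • Y (m + n)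
  | .Y m, .Y n => (((n : ℂ) - m) / 2) • M (m + n + 1)
  | _, _ => 0

/-- The left-symmetric product on `SV`. -/
noncomputable def preLie : SV →ₗ[ℂ] SV →ₗ[ℂ] SV :=
  basis.constr ℂ fun a => basis.constr ℂ fun b => basisPreLie a b

theorem preLie_basis (a b : SVIndex) : preLie (basis a) (basis b) = basisPreLie a b := by
  simp [preLie]

theorem preLie_sub_preLie (x y : SV) : preLie x y - preLie y x = ⁅x, y⁆ := by
  have h : preLie - preLie.flip = bracketHom := by
    refine basis.ext fun a => basis.ext fun b => ?_
    simp only [LinearMap.sub_apply, LinearMap.flip_apply, preLie_basis, bracketHom_basis]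
    cases a <;> cases b <;> simp only [basisPreLie, basisBracket, sub_zero, zero_sub] <;>
      ring_nf <;> try module
  exact LinearMap.congr_fun (LinearMap.congr_fun h x) y

/-- Left symmetry: left multiplications represent $\mathfrak{sv}$ on itself. -/
theorem preLie_lie_basis (a b c : SVIndex) :
    preLie (bracketHom (basis a) (basis b)) (basis c) =
      preLie (basis a) (preLie (basis b) (basis c)) -
        preLie (basis b) (preLie (basis a) (basis c)) := by
  cases a <;> cases b <;> cases c <;>
    simp only [bracketHom_basis, basisBracket, preLie_basis, basisPreLie, L, M, Y, map_smul,
      map_neg, map_zero, LinearMap.smul_apply, LinearMap.neg_apply, LinearMap.zero_apply,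
      smul_zero, neg_zero, sub_zero] <;>
    push_cast <;> ring_nf <;> try module

/-- The inclusion of `SV` as the linear forms in the symmetric algebra. -/
noncomputable def lin : SV →ₗ[ℂ] MvPolynomial SVIndex ℂ :=
  basis.constr ℂ fun a => X a

@[simp]
theorem lin_basis (a : SVIndex) : lin (basis a) = X a := by
  simp [lin]

/-- The derivation of the symmetric algebra extending a linear endomorphism of `SV`. -/
noncomputable def extend :
    (SV →ₗ[ℂ] SV) →ₗ[ℂ] Derivation ℂ (MvPolynomial SVIndex ℂ) (MvPolynomial SVIndex ℂ) where
  toFun T := mkDerivation ℂ fun a => lin (T (basis a))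
  map_add' S T := derivation_ext fun a => by simp
  map_smul' c T := derivation_ext fun a => by simp

@[simp]
theorem extend_X (T : SV →ₗ[ℂ] SV) (a : SVIndex) : extend T (X a) = lin (T (basis a)) := by
  simp [extend]

@[simp]
theorem extend_lin (T : SV →ₗ[ℂ] SV) (x : SV) : extend T (lin x) = lin (T x) := by
  have h : (extend T : MvPolynomial SVIndex ℂ →ₗ[ℂ] MvPolynomial SVIndex ℂ) ∘ₗ lin = lin ∘ₗ T :=
    basis.ext fun a => by simp
  exact LinearMap.congr_fun h x

theorem extend_comp_sub (S T : SV →ₗ[ℂ] SV) :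
    extend (S ∘ₗ T - T ∘ₗ S) = ⁅extend S, extend T⁆ :=
  derivation_ext fun a => by simp [Derivation.commutator_apply, -map_sub, ← map_sub lin]

theorem preLie_lie (x y : SV) : preLie ⁅x, y⁆ = preLie x ∘ₗ preLie y - preLie y ∘ₗ preLie x := by
  have h : bracketHom.compr₂ preLie = (LinearMap.mul ℂ (Module.End ℂ SV)).compl₁₂ preLie preLie -
      ((LinearMap.mul ℂ (Module.End ℂ SV)).compl₁₂ preLie preLie).flip :=
    basis.ext fun a => basis.ext fun b => basis.ext fun c => by
      simpa using preLie_lie_basis a b c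
  exact LinearMap.congr_fun (LinearMap.congr_fun h x) y

/-- The affine action of `SV` on its symmetric algebra: the sum of the derivation extending
left multiplication for the left-symmetric product and of multiplication by the element. -/
noncomputable def affineAction : SV →ₗ[ℂ] Module.End ℂ (MvPolynomial SVIndex ℂ) where
  toFun x := (extend (preLie x) : MvPolynomial SVIndex ℂ →ₗ[ℂ] MvPolynomial SVIndex ℂ) +
    LinearMap.mulLeft ℂ (lin x)
  map_add' x y := LinearMap.ext fun p => by simp; ring
  map_smul' c x := LinearMap.ext fun p => by simp

theorem affineAction_apply (x : SV) (p : MvPolynomial SVIndex ℂ) :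
    affineAction x p = extend (preLie x) p + lin x * p := rfl

/-- The derivation parts commute correctly by left symmetry; the cross terms contribute
multiplication by $x \cdot y - y \cdot x = [x, y]$. -/
theorem affineAction_lie (x y : SV) (p : MvPolynomial SVIndex ℂ) :
    affineAction ⁅x, y⁆ p =
      affineAction x (affineAction y p) - affineAction y (affineAction x p) := by
  have h : lin ⁅x, y⁆ = lin (preLie x y) - lin (preLie y x) := by
    rw [← map_sub, preLie_sub_preLie]
  simp only [affineAction_apply, preLie_lie, extend_comp_sub, Derivation.commutator_apply, h,
    map_add, Derivation.leibniz, extend_lin, smul_eq_mul]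
  ring

attribute [local instance 100] LieRing.ofAssociativeRing in
/-- The affine action as a homomorphism of Lie algebras. -/
noncomputable def affineActionLie : SV →ₗ⁅ℂ⁆ Module.End ℂ (MvPolynomial SVIndex ℂ) :=
  { affineAction with
    map_lie' := fun {x y} => LinearMap.ext fun p => by
      simpa [LieRing.of_associative_ring_bracket] using affineAction_lie x y p }

/-- The action of the enveloping algebra on the symmetric algebra induced by `affineAction`,
evaluated at `1`. -/
noncomputable def toSymm : UniversalEnvelopingAlgebra ℂ SV →ₗ[ℂ] MvPolynomial SVIndex ℂ :=
  LinearMap.applyₗ 1 ∘ₗ (UniversalEnvelopingAlgebra.lift ℂ affineActionLie).toLinearMap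

@[simp]
theorem toSymm_one : toSymm 1 = 1 := by
  simp [toSymm]

theorem toSymm_ι_mul (x : SV) (u : UniversalEnvelopingAlgebra ℂ SV) :
    toSymm (UniversalEnvelopingAlgebra.ι ℂ x * u) =
      extend (preLie x) (toSymm u) + lin x * toSymm u := by
  simp only [toSymm, LinearMap.comp_apply, AlgHom.toLinearMap_apply, map_mul,
    UniversalEnvelopingAlgebra.lift_ι_apply, LinearMap.applyₗ_apply_apply, Module.End.mul_apply]
  rfl

attribute [local instance 100] LieRing.ofAssociativeRing in
theorem ι_lie (x y : SV) :
    UniversalEnvelopingAlgebra.ι ℂ ⁅x, y⁆ =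
      UniversalEnvelopingAlgebra.ι ℂ x * UniversalEnvelopingAlgebra.ι ℂ y -
        UniversalEnvelopingAlgebra.ι ℂ y * UniversalEnvelopingAlgebra.ι ℂ x :=
  (UniversalEnvelopingAlgebra.ι ℂ).map_lie x y

/-! ### Transcendence -/

theorem extend_preLie_M (n : ℤ) : extend (preLie (M n)) = 0 := by
  refine derivation_ext fun a => ?_
  cases a <;> simp [M, preLie_basis, basisPreLie]

theorem transcendental_ι_M (n : ℤ) :
    Transcendental ℂ (UniversalEnvelopingAlgebra.ι ℂ (M n)) := by
  rw [transcendental_iff]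
  intro p hp
  have hpow (k : ℕ) : toSymm (UniversalEnvelopingAlgebra.ι ℂ (M n) ^ k) = X (SVIndex.M n) ^ k := by
    induction k with
    | zero => simp
    | succ k ih =>
      rw [pow_succ', toSymm_ι_mul, ih, extend_preLie_M, M, lin_basis, pow_succ']
      simp
  have h : Polynomial.aeval (X (SVIndex.M n) : MvPolynomial SVIndex ℂ) p = 0 := by
    have := congrArg toSymm hp
    rw [Polynomial.aeval_eq_sum_range] at this ⊢
    simpa [hpow, -UniversalEnvelopingAlgebra.ι_apply] using this
  exact (transcendental_iff.1 (transcendental_X ℂ (SVIndex.M n))) p h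

/-! ### Homogeneous components -/

theorem isHomogeneous_lin (x : SV) : (lin x).IsHomogeneous 1 := by
  have h : (⊤ : Submodule ℂ SV) ≤ (homogeneousSubmodule SVIndex ℂ 1).comap lin := by
    rw [← basis.span_eq, Submodule.span_le]
    rintro _ ⟨a, rfl⟩
    simpa using isHomogeneous_X ℂ a
  exact h (Submodule.mem_top (x := x))

theorem isHomogeneous_extend_monomial (T : SV →ₗ[ℂ] SV) (d : SVIndex →₀ ℕ) (c : ℂ) :
    (extend T (monomial d c)).IsHomogeneous d.degree := by
  classical
  have h : extend T (monomial d c) = mkDerivation ℂ (fun a => lin (T (basis a))) (monomial d c) :=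
    rfl
  rw [h, mkDerivation_monomial]
  refine (homogeneousSubmodule SVIndex ℂ d.degree).smul_mem c
    ((homogeneousSubmodule SVIndex ℂ d.degree).sum_mem fun a ha => ?_)
  have hle : Finsupp.single a 1 ≤ d :=
    Finsupp.single_le_iff.2 (Nat.one_le_iff_ne_zero.2 (Finsupp.mem_support_iff.1 ha))
  have hd : (d - Finsupp.single a 1).degree + 1 = d.degree := by
    conv_rhs => rw [← tsub_add_cancel_of_le hle]
    simp
  beta_reduce
  rw [smul_eq_mul, ← hd]
  exact (isHomogeneous_monomial _ rfl).mul (isHomogeneous_lin _)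

theorem homogeneousComponent_extend (T : SV →ₗ[ℂ] SV) (k : ℕ) (p : MvPolynomial SVIndex ℂ) :
    homogeneousComponent k (extend T p) = extend T (homogeneousComponent k p) := by
  induction p using MvPolynomial.induction_on' with
  | monomial d c =>
    rw [homogeneousComponent_of_mem (isHomogeneous_extend_monomial T d c),
      homogeneousComponent_of_mem (isHomogeneous_monomial c rfl)]
    split_ifs <;> simp
  | add p q hp hq => rw [map_add, map_add, map_add, map_add, hp, hq]

theorem homogeneousComponent_lin_mul (x : SV) (k : ℕ) (p : MvPolynomial SVIndex ℂ) :
    homogeneousComponent (k + 1) (lin x * p) = lin x * homogeneousComponent k p := by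
  induction p using MvPolynomial.induction_on' with
  | monomial d c =>
    have h := (isHomogeneous_lin x).mul (isHomogeneous_monomial (n := d.degree) c rfl)
    rw [homogeneousComponent_of_mem h, homogeneousComponent_of_mem (isHomogeneous_monomial c rfl)]
    split_ifs <;> first | omega | simp
  | add p q hp hq => rw [mul_add, map_add, map_add, mul_add, hp, hq]

/-! ### The standard filtration of the enveloping algebra -/

open UniversalEnvelopingAlgebra (ι)

/-- The ordered product in the enveloping algebra of a list of basis vectors. -/
noncomputable def listProd (l : List SVIndex) : UniversalEnvelopingAlgebra ℂ SV :=
  (l.map fun a => ι ℂ (basis a)).prod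

@[simp]
theorem listProd_nil : listProd [] = 1 := rfl

@[simp]
theorem listProd_cons (a : SVIndex) (l : List SVIndex) :
    listProd (a :: l) = ι ℂ (basis a) * listProd l := by
  simp [listProd, -UniversalEnvelopingAlgebra.ι_apply]

/-- The standard filtration of the enveloping algebra. -/
noncomputable def filtration (k : ℕ) : Submodule ℂ (UniversalEnvelopingAlgebra ℂ SV) :=
  Submodule.span ℂ (listProd '' {l | l.length ≤ k})

theorem listProd_mem {l : List SVIndex} {k : ℕ} (h : l.length ≤ k) : listProd l ∈ filtration k :=
  Submodule.subset_span ⟨l, h, rfl⟩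

theorem filtration_le {k : ℕ} {N : Submodule ℂ (UniversalEnvelopingAlgebra ℂ SV)}
    (h : ∀ l : List SVIndex, l.length ≤ k → listProd l ∈ N) : filtration k ≤ N :=
  Submodule.span_le.2 (Set.image_subset_iff.2 h)

theorem filtration_mono {j k : ℕ} (h : j ≤ k) : filtration j ≤ filtration k :=
  filtration_le fun _ hl => listProd_mem (hl.trans h)

attribute [local instance 100] LieRing.ofAssociativeRing in
theorem ι_mul_mem (x : SV) {k : ℕ} {u : UniversalEnvelopingAlgebra ℂ SV} (hu : u ∈ filtration k) :
    ι ℂ x * u ∈ filtration (k + 1) := by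
  have hbasis (a : SVIndex) : ι ℂ (basis a) * u ∈ filtration (k + 1) := by
    have h : filtration k ≤
        (filtration (k + 1)).comap (LinearMap.mulLeft ℂ (ι ℂ (basis a))) :=
      filtration_le fun l hl => by
        rw [Submodule.mem_comap, LinearMap.mulLeft_apply, ← listProd_cons]
        exact listProd_mem (by simpa using hl)
    exact h hu
  have h : (⊤ : Submodule ℂ SV) ≤
      (filtration (k + 1)).comap (LinearMap.mulRight ℂ u ∘ₗ (ι ℂ : SV →ₗ⁅ℂ⁆ _).toLinearMap) := by
    rw [← basis.span_eq, Submodule.span_le]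
    rintro _ ⟨a, rfl⟩
    exact hbasis a
  exact h (Submodule.mem_top (x := x))

theorem exists_mem_filtration (u : UniversalEnvelopingAlgebra ℂ SV) : ∃ k, u ∈ filtration k := by
  obtain ⟨t, rfl⟩ : ∃ t, UniversalEnvelopingAlgebra.mkAlgHom ℂ SV t = u := RingCon.mkₐ_surjective _ u
  have ht : t ∈ Algebra.adjoin ℂ (Set.range (TensorAlgebra.ι ℂ (M := SV))) := by
    rw [TensorAlgebra.adjoin_range_ι]; trivial
  rw [← Subalgebra.mem_toSubmodule, Algebra.adjoin_eq_span] at ht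
  induction ht using Submodule.span_induction with
  | mem t ht =>
    obtain ⟨l, hl, rfl⟩ := Submonoid.exists_list_of_mem_closure ht
    refine ⟨l.length, ?_⟩
    clear ht
    induction l with
    | nil => simpa using listProd_mem (l := []) le_rfl
    | cons a l ih =>
      obtain ⟨x, rfl⟩ := hl a (by simp)
      rw [List.prod_cons, map_mul]
      exact ι_mul_mem x (ih fun y hy => hl y (by simp [hy]))
  | zero => exact ⟨0, by simp⟩
  | add s t _ _ hs ht =>
    obtain ⟨j, hj⟩ := hs
    obtain ⟨k, hk⟩ := ht
    refine ⟨max j k, ?_⟩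
    rw [map_add]
    exact add_mem (filtration_mono (le_max_left _ _) hj) (filtration_mono (le_max_right _ _) hk)
  | smul c t _ ht =>
    obtain ⟨k, hk⟩ := ht
    exact ⟨k, by rw [map_smul]; exact Submodule.smul_mem _ c hk⟩

/-- Swapping two adjacent factors costs a bracket, which is one letter shorter. -/
theorem listProd_sub_mem_of_perm {l l' : List SVIndex} (h : l.Perm l') {k : ℕ}
    (hl : l.length ≤ k + 1) : listProd l - listProd l' ∈ filtration k := by
  induction h generalizing k with
  | nil => simp
  | @cons a l l' h ih =>
    rw [listProd_cons, listProd_cons, ← mul_sub]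
    rcases k with _ | k
    · have hnil : l = [] := by simpa using hl
      subst hnil
      simp [h.nil_eq]
    · exact ι_mul_mem _ (ih (by simpa using hl))
  | swap a b l =>
    simp only [List.length_cons, add_le_add_iff_right] at hl
    obtain ⟨k, rfl⟩ : ∃ j, k = j + 1 := ⟨k - 1, by omega⟩
    have h : listProd (b :: a :: l) - listProd (a :: b :: l) =
        ι ℂ ⁅basis b, basis a⁆ * listProd l := by
      simp only [listProd_cons, ι_lie]
      noncomm_ring
    rw [h]
    exact ι_mul_mem _ (listProd_mem (by omega))
  | trans h₁ _ ih₁ ih₂ =>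
    rw [← sub_add_sub_cancel]
    exact add_mem (ih₁ hl) (ih₂ (h₁.length_eq ▸ hl))

/-! ### Principal symbols -/

/-- The principal symbol of an element of the `k`-th piece of the filtration. -/
noncomputable def symbol (k : ℕ) : UniversalEnvelopingAlgebra ℂ SV →ₗ[ℂ] MvPolynomial SVIndex ℂ :=
  homogeneousComponent k ∘ₗ toSymm

theorem symbol_isHomogeneous (k : ℕ) (u : UniversalEnvelopingAlgebra ℂ SV) :
    (symbol k u).IsHomogeneous k :=
  homogeneousComponent_isHomogeneous k _

theorem symbol_succ_ι_mul (x : SV) (k : ℕ) (u : UniversalEnvelopingAlgebra ℂ SV) :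
    symbol (k + 1) (ι ℂ x * u) = extend (preLie x) (symbol (k + 1) u) + lin x * symbol k u := by
  simp only [symbol, LinearMap.comp_apply, toSymm_ι_mul, map_add, homogeneousComponent_extend,
    homogeneousComponent_lin_mul]

theorem symbol_listProd_of_lt {l : List SVIndex} {k : ℕ} (h : l.length < k) :
    symbol k (listProd l) = 0 := by
  obtain ⟨k, rfl⟩ : ∃ j, k = j + 1 := ⟨k - 1, by omega⟩
  induction l generalizing k with
  | nil =>
    simp only [symbol, LinearMap.comp_apply, listProd_nil, toSymm_one]
    exact homogeneousComponent_eq_zero _ _ (by simp)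
  | cons a l ih =>
    simp only [List.length_cons, add_lt_add_iff_right] at h
    obtain ⟨k, rfl⟩ : ∃ j, k = j + 1 := ⟨k - 1, by omega⟩
    rw [listProd_cons, symbol_succ_ι_mul, ih _ h, ih _ (by omega)]
    simp

theorem symbol_eq_zero {j k : ℕ} (h : j < k) {u : UniversalEnvelopingAlgebra ℂ SV}
    (hu : u ∈ filtration j) : symbol k u = 0 :=
  filtration_le (N := LinearMap.ker (symbol k))
    (fun _ hl => symbol_listProd_of_lt (lt_of_le_of_lt hl h)) hu

theorem symbol_ι_mul (x : SV) {k : ℕ} {u : UniversalEnvelopingAlgebra ℂ SV}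
    (hu : u ∈ filtration k) : symbol (k + 1) (ι ℂ x * u) = lin x * symbol k u := by
  rw [symbol_succ_ι_mul, symbol_eq_zero k.lt_succ_self hu, map_zero, zero_add]

theorem symbol_listProd (l : List SVIndex) :
    symbol l.length (listProd l) = (l.map X).prod := by
  induction l with
  | nil => simp [symbol, homogeneousComponent_zero]
  | cons a l ih =>
    rw [listProd_cons, List.length_cons, symbol_ι_mul _ (listProd_mem le_rfl), ih]
    simp

/-- The derivation of the symmetric algebra extending the adjoint action of an element. -/
noncomputable def adSymm (x : SV) :
    Derivation ℂ (MvPolynomial SVIndex ℂ) (MvPolynomial SVIndex ℂ) :=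
  extend (bracketHom x)

theorem adSymm_lin (x y : SV) : adSymm x (lin y) = lin ⁅x, y⁆ := extend_lin _ _

theorem adSymm_X (x : SV) (a : SVIndex) : adSymm x (X a) = lin ⁅x, basis a⁆ := extend_X _ _

/-- On words, the commutator with $x$ obeys the Leibniz rule letter by letter, just like `adSymm x`
on monomials. Hence central elements have invariant symbols. -/
theorem commutator_mem_and_symbol (x : SV) {k : ℕ} {u : UniversalEnvelopingAlgebra ℂ SV}
    (hu : u ∈ filtration k) :
    ι ℂ x * u - u * ι ℂ x ∈ filtration k ∧
      symbol k (ι ℂ x * u - u * ι ℂ x) = adSymm x (symbol k u) := by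
  have hlist (l : List SVIndex) :
      ι ℂ x * listProd l - listProd l * ι ℂ x ∈ filtration l.length ∧
        symbol l.length (ι ℂ x * listProd l - listProd l * ι ℂ x) =
          adSymm x (symbol l.length (listProd l)) := by
    induction l with
    | nil => simp [symbol, homogeneousComponent_zero]
    | cons a l ih =>
      have h : ι ℂ x * listProd (a :: l) - listProd (a :: l) * ι ℂ x =
          ι ℂ ⁅x, basis a⁆ * listProd l +
            ι ℂ (basis a) * (ι ℂ x * listProd l - listProd l * ι ℂ x) := by
        simp only [listProd_cons, ι_lie]
        noncomm_ring
      have hl : listProd l ∈ filtration l.length := listProd_mem le_rfl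
      rw [h, List.length_cons, map_add, symbol_ι_mul _ hl, symbol_ι_mul _ ih.1, ih.2,
        listProd_cons, symbol_ι_mul _ hl, Derivation.leibniz, adSymm_lin]
      refine ⟨add_mem (ι_mul_mem _ hl) (ι_mul_mem _ ih.1), ?_⟩
      simp only [smul_eq_mul]
      ring
  let ad := LinearMap.mulLeft ℂ (ι ℂ x) - LinearMap.mulRight ℂ (ι ℂ x)
  have hle : filtration k ≤ (filtration k).comap ad ⊓
      LinearMap.ker (symbol k ∘ₗ ad - (adSymm x : _ →ₗ[ℂ] _) ∘ₗ symbol k) := by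
    refine filtration_le fun l hl => ⟨filtration_mono hl (hlist l).1, ?_⟩
    rw [SetLike.mem_coe, LinearMap.mem_ker, LinearMap.sub_apply, sub_eq_zero]
    -- For words shorter than `k` both sides vanish.
    rcases hl.eq_or_lt with rfl | hl
    · exact (hlist l).2
    · have h₁ : symbol k (ad (listProd l)) = 0 := symbol_eq_zero hl (hlist l).1
      have h₂ : symbol k (listProd l) = 0 := symbol_listProd_of_lt hl
      simp [h₁, h₂]
  exact ⟨(hle hu).1, sub_eq_zero.1 (hle hu).2⟩

/-- The linear section of the symbol maps given by ordering monomials arbitrarily. -/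
noncomputable def ofSymm : MvPolynomial SVIndex ℂ →ₗ[ℂ] UniversalEnvelopingAlgebra ℂ SV :=
  (basisMonomials SVIndex ℂ).constr ℂ fun d => listProd (Finsupp.toMultiset d).toList

theorem ofSymm_monomial (d : SVIndex →₀ ℕ) (c : ℂ) :
    ofSymm (monomial d c) = c • listProd (Finsupp.toMultiset d).toList := by
  have h : monomial d c = c • basisMonomials SVIndex ℂ d := by simp [smul_monomial]
  rw [h, map_smul, ofSymm, Module.Basis.constr_basis]

theorem exists_perm_ofSymm (l : List SVIndex) :
    ∃ l' : List SVIndex, l.Perm l' ∧ ofSymm (l.map X).prod = listProd l' := by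
  classical
  have h : (l.map X).prod = monomial (Multiset.toFinsupp (l : Multiset SVIndex)) (1 : ℂ) := by
    induction l with
    | nil => simp
    | cons a l ih =>
      rw [List.map_cons, List.prod_cons, ih, ← Multiset.cons_coe, ← Multiset.singleton_add,
        map_add, Multiset.toFinsupp_singleton, X, monomial_mul, one_mul]
  refine ⟨_, ?_, by rw [h, ofSymm_monomial, one_smul]⟩
  rw [← Multiset.coe_eq_coe, Multiset.coe_toList, Multiset.toFinsupp_toMultiset]

/-- A word of full length differs from the reordered word chosen by `ofSymm` only in lower
filtration, so the symbol determines the leading part. -/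
theorem sub_ofSymm_symbol_mem {k : ℕ} {u : UniversalEnvelopingAlgebra ℂ SV}
    (hu : u ∈ filtration (k + 1)) : u - ofSymm (symbol (k + 1) u) ∈ filtration k := by
  refine filtration_le (N := (filtration k).comap (LinearMap.id - ofSymm ∘ₗ symbol (k + 1)))
    (fun l hl => ?_) hu
  simp only [Submodule.mem_comap, LinearMap.sub_apply, LinearMap.id_apply, LinearMap.comp_apply]
  rcases hl.eq_or_lt with hl' | hl'
  · obtain ⟨l', hp, h⟩ := exists_perm_ofSymm l
    rw [← hl', symbol_listProd, h]
    exact listProd_sub_mem_of_perm hp hl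
  · rw [symbol_listProd_of_lt hl', map_zero, sub_zero]
    exact listProd_mem (Nat.lt_succ_iff.1 hl')

/-! ### Invariants of the symmetric algebra -/

/-- Both terms of $\partial_b(Df) - D(\partial_b f)$ vanish, leaving $c\,\partial_a f = 0$. -/
theorem pderiv_eq_zero_of_commutator
    {D : Derivation ℂ (MvPolynomial SVIndex ℂ) (MvPolynomial SVIndex ℂ)}
    {a b : SVIndex} {c : ℂ} (hc : c ≠ 0) (h : ⁅pderiv (R := ℂ) b, D⁆ = c • pderiv a)
    {f : MvPolynomial SVIndex ℂ} (hb : b ∉ f.vars) (hD : D f = 0) : pderiv a f = 0 := by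
  have := congrArg (fun E => E f) h
  rw [Derivation.commutator_apply, hD, pderiv_eq_zero_of_notMem_vars hb] at this
  simpa [hc] using this.symm

theorem commutator_pderiv_X (b : SVIndex)
    (D : Derivation ℂ (MvPolynomial SVIndex ℂ) (MvPolynomial SVIndex ℂ)) (a : SVIndex) :
    ⁅pderiv (R := ℂ) b, D⁆ (X a) = pderiv b (D (X a)) := by
  classical
  rw [Derivation.commutator_apply, pderiv_X, Pi.single_apply]
  split_ifs <;> simp

/-- Among the brackets of $M_n$ with basis vectors, only $[M_n, L_m]$ involves $M_{n+m}$ when $n \ne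
0$. -/
theorem commutator_adSymm_M (n m : ℤ) :
    ⁅pderiv (R := ℂ) (SVIndex.M (n + m)), adSymm (M n)⁆ = (-n : ℂ) • pderiv (SVIndex.L m) := by
  refine derivation_ext fun a => ?_
  cases a with
  | L k => 
    rcases eq_or_ne k m with rfl | h
    · simp [commutator_pderiv_X, adSymm_X, M,  lie_basis, basisBracket]
    · simp [commutator_pderiv_X, adSymm_X, M,  lie_basis, basisBracket, h]
  | M k => simp [commutator_pderiv_X, adSymm_X, M, lie_basis, basisBracket]
  | Y k => simp [commutator_pderiv_X, adSymm_X, M, lie_basis, basisBracket]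

theorem commutator_adSymm_Y (n m : ℤ) :
    ⁅pderiv (R := ℂ) (SVIndex.M (n + m + 1)), adSymm (Y n)⁆ = (m - n : ℂ) • pderiv (SVIndex.Y m) := by
  refine derivation_ext fun a => ?_
  cases a with
  | L k => simp [commutator_pderiv_X, adSymm_X, Y, lie_basis, basisBracket]
  | M k => simp [commutator_pderiv_X, adSymm_X, Y, lie_basis, basisBracket]
  | Y k => 
    rcases eq_or_ne k m with rfl | h
    · simp [commutator_pderiv_X, adSymm_X, M, Y, lie_basis, basisBracket]
    · simp [commutator_pderiv_X, adSymm_X, M, Y, lie_basis, basisBracket, h]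

theorem commutator_adSymm_L (n m : ℤ) :
    ⁅pderiv (R := ℂ) (SVIndex.M (m + n)), adSymm (L n)⁆ = (m : ℂ) • pderiv (SVIndex.M m) := by
  refine derivation_ext fun a => ?_
  cases a with
  | L k => simp [commutator_pderiv_X, adSymm_X, L, lie_basis, basisBracket]
  | M k => 
    rcases eq_or_ne k m with rfl | h
    · simp [commutator_pderiv_X, adSymm_X, M, L, lie_basis, basisBracket]
    · simp [commutator_pderiv_X, adSymm_X, M, L, lie_basis, basisBracket, h]
  | Y k => simp [commutator_pderiv_X, adSymm_X, L, Y, lie_basis, basisBracket]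

theorem pderiv_eq_zero_of_invariant {f : MvPolynomial SVIndex ℂ} (hf : ∀ x, adSymm x f = 0)
    {a : SVIndex} (ha : a ≠ SVIndex.M 0) : pderiv a f = 0 := by
  have hfin : {n : ℤ | SVIndex.M n ∈ f.vars}.Finite :=
    f.vars.finite_toSet.preimage (Function.Injective.injOn fun _ _ h => by simpa using h)
  -- The excluded value `t` is where the commutator's coefficient would vanish: $-n$ for `L m`, $m -
  -- n$ for `Y m`. For `M m` the coefficient is $m$ itself, so `t` is irrelevant there, and $m = 0$
  -- is the one exception.
  have havoid (s t : ℤ) : ∃ n : ℤ, n ≠ t ∧ SVIndex.M (n + s) ∉ f.vars := by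
    have h := (hfin.preimage (f := fun n => n + s) (add_left_injective s).injOn).union
      (Set.finite_singleton t)
    obtain ⟨n, hn⟩ := h.exists_notMem
    exact ⟨n, fun h => hn (Or.inr h), fun h => hn (Or.inl h)⟩
  cases a with
  | L m =>
    obtain ⟨n, hn, hv⟩ := havoid m 0
    exact pderiv_eq_zero_of_commutator (by simpa using hn) (commutator_adSymm_M n m) hv (hf _)
  | Y m =>
    obtain ⟨n, hn, hv⟩ := havoid (m + 1) m
    rw [← add_assoc] at hv
    exact pderiv_eq_zero_of_commutator (sub_ne_zero.2 (by exact_mod_cast hn.symm))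
      (commutator_adSymm_Y n m) hv (hf _)
  | M m =>
    obtain ⟨n, -, hv⟩ := havoid m 0
    rw [add_comm] at hv
    exact pderiv_eq_zero_of_commutator (by simpa using ha) (commutator_adSymm_L n m) hv (hf _)

theorem eq_monomial_of_invariant {f : MvPolynomial SVIndex ℂ} (hf : ∀ x, adSymm x f = 0) {k : ℕ}
    (hk : f.IsHomogeneous k) : ∃ c, f = monomial (Finsupp.single (SVIndex.M 0) k) c := by
  classical
  refine ⟨coeff (Finsupp.single (SVIndex.M 0) k) f, ext _ _ fun d => ?_⟩
  rw [coeff_monomial]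
  split_ifs with hd
  · rw [hd]
  by_contra hne
  refine hd ?_
  have hzero (a : SVIndex) (ha : a ≠ SVIndex.M 0) : d a = 0 := by
    by_contra hda
    -- This coefficient of $\partial_a f$ is a positive integer multiple of the coefficient of `f`
    -- at `d`.
    have h := congrArg (coeff (d - Finsupp.single a 1)) (pderiv_eq_zero_of_invariant hf ha)
    rw [coeff_pderiv, coeff_zero, tsub_add_cancel_of_le
      (Finsupp.single_le_iff.2 (Nat.one_le_iff_ne_zero.2 hda))] at h
    refine (mul_eq_zero.1 h).elim hne ?_
    norm_cast
  have hs : d = Finsupp.single (SVIndex.M 0) (d (SVIndex.M 0)) := by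
    ext a
    rw [Finsupp.single_apply]
    split_ifs with h
    · rw [h]
    · exact hzero a (Ne.symm h)
  have hdeg : d.degree = k := by
    by_contra h
    exact hne (hk.coeff_eq_zero h)
  rw [hs, Finsupp.degree_single] at hdeg
  rw [hs, hdeg]

/-! ### The center -/

theorem commute_ι_M_zero (x : SV) : Commute (ι ℂ x) (ι ℂ (M 0)) := by
  have h : bracketHom.flip (M 0) = 0 := basis.ext fun a => by
    cases a <;> simp [M, bracketHom_basis, basisBracket]
  have h' : ⁅x, M 0⁆ = 0 := LinearMap.congr_fun h x
  rw [commute_iff_eq, ← sub_eq_zero, ← ι_lie, h', map_zero]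

theorem mem_adjoin_of_commute {k : ℕ} {z : UniversalEnvelopingAlgebra ℂ SV} (hz : z ∈ filtration k)
    (hc : ∀ x, ι ℂ x * z - z * ι ℂ x = 0) : z ∈ Algebra.adjoin ℂ {ι ℂ (M 0)} := by
  induction k generalizing z with
  | zero =>
    refine filtration_le (N := Subalgebra.toSubmodule (Algebra.adjoin ℂ {ι ℂ (M 0)}))
      (fun l hl => ?_) hz
    rw [List.eq_nil_of_length_eq_zero (Nat.le_zero.1 hl)]
    exact one_mem (Algebra.adjoin ℂ {ι ℂ (M 0)})
  | succ k ih =>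
    have hinv (x : SV) : adSymm x (symbol (k + 1) z) = 0 := by
      rw [← (commutator_mem_and_symbol x hz).2, hc, map_zero]
    obtain ⟨c, hf⟩ := eq_monomial_of_invariant hinv (symbol_isHomogeneous _ _)
    have hrep : (Multiset.replicate (k + 1) (SVIndex.M 0)).toList =
        List.replicate (k + 1) (SVIndex.M 0) :=
      List.perm_replicate.1 (Multiset.coe_eq_coe.1 (by rw [Multiset.coe_toList, Multiset.coe_replicate]))
    have hs : ofSymm (symbol (k + 1) z) = c • ι ℂ (M 0) ^ (k + 1) := by
      rw [hf, ofSymm_monomial, Finsupp.toMultiset_single, Multiset.nsmul_singleton,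
        hrep, listProd, List.map_replicate, List.prod_replicate, M]
    have hrec := sub_ofSymm_symbol_mem hz
    rw [hs] at hrec
    -- The difference is still central, since $M_0$ is.
    have hmem := ih hrec fun x => by
      rw [sub_eq_zero]
      exact (Commute.sub_right (sub_eq_zero.1 (hc x)) (((commute_ι_M_zero x).pow_right _).smul_right c)).eq
    have hpow : c • ι ℂ (M 0) ^ (k + 1) ∈ Algebra.adjoin ℂ {ι ℂ (M 0)} :=
      Subalgebra.smul_mem _ (pow_mem (Algebra.self_mem_adjoin_singleton ℂ _) _) c
    simpa using add_mem hmem hpow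

theorem ι_M_zero_mem_center : ι ℂ (M 0) ∈ Subalgebra.center ℂ (UniversalEnvelopingAlgebra ℂ SV) := by
  refine Subalgebra.mem_center_iff.2 fun u => ?_
  obtain ⟨k, hk⟩ := exists_mem_filtration u
  have h : filtration k ≤ Subalgebra.toSubmodule (Subalgebra.centralizer ℂ {ι ℂ (M 0)}) :=
    filtration_le fun l _ => by
      refine list_prod_mem (S := Subalgebra.centralizer ℂ {ι ℂ (M 0)}) fun y hy => ?_
      obtain ⟨a, -, rfl⟩ := List.mem_map.1 hy
      exact (Subalgebra.mem_centralizer_iff ℂ).2 fun y hy => by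
        rw [Set.mem_singleton_iff.1 hy]
        exact (commute_ι_M_zero _).symm.eq
  exact ((Subalgebra.mem_centralizer_iff ℂ).1 (h hk) _ rfl).symm

end SV

theorem corollary3p6 :
    Subalgebra.center ℂ (UniversalEnvelopingAlgebra ℂ SV) =
        Algebra.adjoin ℂ {UniversalEnvelopingAlgebra.ι ℂ (SV.M 0)} ∧
      Transcendental ℂ (UniversalEnvelopingAlgebra.ι ℂ (SV.M 0)) := by
  refine ⟨le_antisymm (fun z hz => ?_) (Algebra.adjoin_le ?_), SV.transcendental_ι_M 0⟩
  · obtain ⟨k, hk⟩ := SV.exists_mem_filtration z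
    exact SV.mem_adjoin_of_commute hk fun x =>
      sub_eq_zero.2 (Subalgebra.mem_center_iff.1 hz _)
  · rw [Set.singleton_subset_iff]
    exact SV.ι_M_zero_mem_center
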